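/- Let $\Gamma$ be a simplicial graph (possibly infinite or disconnected) with vertex set $V(\Gamma)$ and let $\mathcal G=\{G_v\}_{v\in V(\Gamma)}$ be a collection of groups. Let $$\Gamma\mathcal G=\ast_{v\in V(\Gamma)}G_v\,\big/\,\langle\!\langle\{[g_v,g_w] \mid (v,w)\in E(\Gamma),\ g_v\in G_v,\ g_w\in G_w\}\rangle\!\rangle$$ be the graph product, and let $X$ be the Cayley graph of $\Gamma\mathcal G$ with respect to the generating set $\bigcup_{v\in V(\Gamma)}(G_v\setminus\{1\})$. (1) If $\mathrm{girth}(\Gamma)>4$ (where $\mathrm{girth}(\Gamma)=\infty$ if $\Gamma$ contains no circuit), then $X$ is hyperbolic, i.e. $X$ is connected and the geodesic metric space obtained from $X$ by giving every edge length $1$ is Gromov hyperbolic: there is $\delta\in\mathbb N$ such that $(x,z)_w\ge\min\{(x,y)_w,(y,z)_w\}-\delta$ for all points $w,x,y,z$, where $(x,y)_w=\frac12(d_X(x,w)+d_X(y,w)-d_X(x,y))$. For an edge $e$ of $X$ and $n\in\mathbb N$, let $\mathscr C_X(e,n)$ be the set of circuits of $X$ (closed paths of length greater than $2$ without self-intersection)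 of length at most $n$ that contain $e$. (2) If $\Gamma$ is locally finite and every $G_v$ is finite, then $X$ is fine, i.e. $\mathscr C_X(e,n)$ is finite for every edge $e$ of $X$ and every $n\in\mathbb N$. (3) If $\Gamma$ is uniformly locally finite (the valencies of its vertices are bounded by one constant), every $G_v$ is finite and $\sup_{v\in V(\Gamma)}|G_v|<\infty$, then $X$ is uniformly fine, i.e. there is a function $f\colon\mathbb N\to\mathbb N$ such that $|\mathscr C_X(e,n)|\le f(n)$ for every edge $e$ of $X$ and every $n\in\mathbb N$. -/

import Mathlib

/-! ### Graph products of groups -/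

/-- The normal subgroup of the free product `∗_{v} G v` generated by the commutators
`[a, b] = a b a⁻¹ b⁻¹`, `a ∈ G v`, `b ∈ G w`, with `v`, `w` adjacent in `Γ`. -/
def GraphProduct.relations {V : Type*} (Γ : SimpleGraph V) (G : V → Type*)
    [∀ v, Group (G v)] : Subgroup (Monoid.CoprodI G) :=
  Subgroup.normalClosure
    {x | ∃ (v w : V) (a : G v) (b : G w), Γ.Adj v w ∧
      x = Monoid.CoprodI.of a * Monoid.CoprodI.of b *
        (Monoid.CoprodI.of a)⁻¹ * (Monoid.CoprodI.of b)⁻¹}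

instance GraphProduct.relations_normal {V : Type*} (Γ : SimpleGraph V) (G : V → Type*)
    [∀ v, Group (G v)] : (GraphProduct.relations Γ G).Normal :=
  Subgroup.normalClosure_normal

/-- The graph product of the groups `G v` over the simplicial graph `Γ`. -/
abbrev GraphProduct {V : Type*} (Γ : SimpleGraph V) (G : V → Type*)
    [∀ v, Group (G v)] : Type _ :=
  Monoid.CoprodI G ⧸ GraphProduct.relations Γ G

/-- The canonical homomorphism from the vertex group `G v` to the graph product. -/
def GraphProduct.of {V : Type*} (Γ : SimpleGraph V) (G : V → Type*)
    [∀ v, Group (G v)] (v : V) : G v →* GraphProduct Γ G :=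
  (QuotientGroup.mk' (GraphProduct.relations Γ G)).comp Monoid.CoprodI.of

/-- The generating set `⋃ v, (G v \ {1})` of the graph product. -/
def GraphProduct.syllables {V : Type*} (Γ : SimpleGraph V) (G : V → Type*)
    [∀ v, Group (G v)] : Set (GraphProduct Γ G) :=
  ⋃ v : V, GraphProduct.of Γ G v '' {a : G v | a ≠ 1}

/-- The Cayley graph of the graph product with respect to `⋃ v, (G v \ {1})`:
`g` and `h` are adjacent iff `g ≠ h` and `h = g * s` or `g = h * s` for some syllable `s`. -/
def GraphProduct.cayleyGraph {V : Type*} (Γ : SimpleGraph V) (G : V → Type*)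
    [∀ v, Group (G v)] : SimpleGraph (GraphProduct Γ G) :=
  SimpleGraph.mulCayley (GraphProduct.syllables Γ G)

/-! ### Hyperbolic metric spaces -/

/-- The Gromov product `(x, y)_z`. -/
noncomputable def gromovProduct {X : Type*} [MetricSpace X] (x y z : X) : ℝ :=
  (dist x z + dist y z - dist x y) / 2

/-- Gromov's four point condition for some `δ`. -/
def IsGromovHyperbolic (X : Type*) [MetricSpace X] : Prop :=
  ∃ δ : ℕ, ∀ w x y z : X,
    gromovProduct x z w ≥ min (gromovProduct x y w) (gromovProduct y z w) - δ

namespace SimpleGraph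

/-! ### The geometric realization of a graph -/

/-- The closed edge `{u, v}` (a single point when `u = v`) in barycentric coordinates. -/
def edgeSegment {V : Type*} (u v : V) : Set (V →₀ ℝ) :=
  segment ℝ (Finsupp.single u 1) (Finsupp.single v 1)

/-- The geometric realization of a graph: the union of its vertices and of its closed edges, a
point being given by its barycentric coordinates. -/
def Realization {V : Type*} (G : SimpleGraph V) : Type _ :=
  {x : V →₀ ℝ // ∃ u v : V, (u = v ∨ G.Adj u v) ∧ x ∈ edgeSegment u v}

/-- Two points lie on a common closed edge (or are the same vertex). -/
def OnCommonEdge {V : Type*} {G : SimpleGraph V} (x y : G.Realization) : Prop :=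
  ∃ u v : V, (u = v ∨ G.Adj u v) ∧ x.1 ∈ edgeSegment u v ∧ y.1 ∈ edgeSegment u v

open Classical in
/-- The path metric on the geometric realization in which every edge is isometric to `[0, 1]`.
On one closed edge, `(1 - s) u + s v` and `(1 - t) u + t v` have distance `|s - t|`. Otherwise
a path from `x` to `y` leaves the edge of `x` at an endpoint `u`, at distance `1 - x u` from `x`,
and enters the edge of `y` at an endpoint `v`, at distance `1 - y v` from `y`. -/
noncomputable def pathDist {V : Type*} (G : SimpleGraph V) (x y : G.Realization) : ℝ :=
  if OnCommonEdge x y then ⨆ w : V, |x.1 w - y.1 w|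
  else ⨅ p : x.1.support × y.1.support, (1 - x.1 p.1) + (G.dist p.1.1 p.2.1 : ℝ) + (1 - y.1 p.2)

section realization

variable {V : Type*} {G : SimpleGraph V}

theorem mem_edgeSegment {u v : V} {x : V →₀ ℝ} (h : x ∈ edgeSegment u v) :
    ∃ a b : ℝ, 0 ≤ a ∧ 0 ≤ b ∧ a + b = 1 ∧
      x = Finsupp.single u a + Finsupp.single v b := by
  obtain ⟨a, b, ha, hb, hab, rfl⟩ := h
  exact ⟨a, b, ha, hb, hab, by simp⟩

theorem Realization.coord_nonneg (x : G.Realization) (w : V) : 0 ≤ x.1 w := by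
  classical
  obtain ⟨x, u, v, huv, hx⟩ := x
  obtain ⟨a, b, ha, hb, hab, rfl⟩ := mem_edgeSegment hx
  simp only [Finsupp.add_apply, Finsupp.single_apply]
  split_ifs <;> linarith

theorem Realization.coord_add_le (x : G.Realization) {w w' : V} (h : w ≠ w') :
    x.1 w + x.1 w' ≤ 1 := by
  classical
  obtain ⟨x, u, v, huv, hx⟩ := x
  obtain ⟨a, b, ha, hb, hab, rfl⟩ := mem_edgeSegment hx
  simp only [Finsupp.add_apply, Finsupp.single_apply]
  split_ifs with h1 h2 h3 h4 <;> first | linarith | (exfalso; apply h; simp_all)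

theorem Realization.coord_le (x : G.Realization) (w : V) : x.1 w ≤ 1 := by
  classical
  obtain ⟨x, u, v, huv, hx⟩ := x
  obtain ⟨a, b, ha, hb, hab, rfl⟩ := mem_edgeSegment hx
  simp only [Finsupp.add_apply, Finsupp.single_apply]
  split_ifs <;> linarith

theorem Realization.support_nonempty (x : G.Realization) : x.1.support.Nonempty := by
  obtain ⟨x, u, v, huv, hx⟩ := x
  obtain ⟨a, b, ha, hb, hab, rfl⟩ := mem_edgeSegment hx
  rw [Finsupp.support_nonempty_iff]
  intro h0
  have h1 := congrArg (fun f : V →₀ ℝ => f.sum fun _ r => r) h0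
  simp only [Finsupp.sum_zero_index] at h1
  rw [Finsupp.sum_add_index' (by simp) (by simp)] at h1
  simp at h1
  linarith

theorem Realization.eq_single (x : G.Realization) {w : V} (h : x.1 w = 1) :
    x.1 = Finsupp.single w 1 := by
  classical
  ext w'
  rw [Finsupp.single_apply]
  split_ifs with hw
  · rw [← hw, h]
  · have := x.coord_add_le hw
    have := x.coord_nonneg w'
    linarith

theorem edge_of_mem_support {u v w : V} {x : V →₀ ℝ} (hx : x ∈ edgeSegment u v)
    (hw : w ∈ x.support) : w = u ∨ w = v := by
  classical
  obtain ⟨a, b, -, -, -, rfl⟩ := mem_edgeSegment hx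
  by_contra! h
  rw [Finsupp.mem_support_iff] at hw
  apply hw
  simp [h.1.symm, h.2.symm]

theorem dist_le_of_mem_support (x : G.Realization) {u v : V}
    (hu : u ∈ x.1.support) (hv : v ∈ x.1.support) :
    (G.dist u v : ℝ) ≤ (1 - x.1 u) + (1 - x.1 v) := by
  by_cases h : u = v
  · subst h
    have := x.coord_le u
    simp
    linarith
  · obtain ⟨a, b, hab, hx⟩ := x.2
    have hadj : G.Adj u v := by
      rcases edge_of_mem_support hx hu with rfl | rfl <;>
        rcases edge_of_mem_support hx hv with rfl | rfl
      · exact absurd rfl h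
      · exact hab.resolve_left h
      · exact (hab.resolve_left fun e => h e.symm).symm
      · exact absurd rfl h
    have h1 : G.dist u v = 1 := SimpleGraph.dist_eq_one_iff_adj.2 hadj
    have := x.coord_add_le h
    rw [h1]
    push_cast
    linarith

theorem bddAbove_coord (x y : G.Realization) :
    BddAbove (Set.range fun w : V => |x.1 w - y.1 w|) := by
  refine ⟨1, ?_⟩
  rintro _ ⟨w, rfl⟩
  have := x.coord_le w
  have := y.coord_le w
  have := x.coord_nonneg w
  have := y.coord_nonneg w
  exact abs_le.2 ⟨by linarith, by linarith⟩

theorem sup_coord_le (hG : G.Connected) (x y : G.Realization) (u v : V) :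
    (⨆ w : V, |x.1 w - y.1 w|) ≤ (1 - x.1 u) + (G.dist u v : ℝ) + (1 - y.1 v) := by
  have : Nonempty V := ⟨u⟩
  refine ciSup_le fun w => ?_
  have hxw := x.coord_le w
  have hyw := y.coord_le w
  have hxw0 := x.coord_nonneg w
  have hyw0 := y.coord_nonneg w
  have hxu := x.coord_le u
  have hyv := y.coord_le v
  by_cases huv : u = v
  · subst huv
    simp only [SimpleGraph.dist_self, Nat.cast_zero]
    by_cases hw : w = u
    · subst hw
      exact abs_le.2 ⟨by linarith, by linarith⟩
    · have := x.coord_add_le hw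
      have := y.coord_add_le hw
      exact abs_le.2 ⟨by linarith, by linarith⟩
  · have h1 : (1 : ℝ) ≤ (G.dist u v : ℝ) := by
      exact_mod_cast hG.pos_dist_of_ne huv
    exact abs_le.2 ⟨by linarith, by linarith⟩

theorem pathDist_le (hG : G.Connected) (x y : G.Realization) {u v : V}
    (hu : u ∈ x.1.support) (hv : v ∈ y.1.support) :
    G.pathDist x y ≤ (1 - x.1 u) + (G.dist u v : ℝ) + (1 - y.1 v) := by
  unfold pathDist
  split_ifs with h
  · exact sup_coord_le hG x y u v
  · exact ciInf_le (Set.finite_range _).bddBelow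
      ((⟨u, hu⟩, ⟨v, hv⟩) : x.1.support × y.1.support)

theorem pathDist_of_onCommonEdge {x y : G.Realization} (h : OnCommonEdge x y) :
    G.pathDist x y = ⨆ w : V, |x.1 w - y.1 w| := if_pos h

theorem exists_pathDist_eq {x y : G.Realization} (h : ¬ OnCommonEdge x y) :
    ∃ u ∈ x.1.support, ∃ v ∈ y.1.support,
      G.pathDist x y = (1 - x.1 u) + (G.dist u v : ℝ) + (1 - y.1 v) := by
  have := x.support_nonempty.to_subtype
  have := y.support_nonempty.to_subtype
  obtain ⟨p, hp⟩ := exists_eq_ciInf_of_finite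
    (f := fun p : x.1.support × y.1.support =>
      (1 - x.1 p.1) + (G.dist p.1.1 p.2.1 : ℝ) + (1 - y.1 p.2))
  exact ⟨p.1, p.1.2, p.2, p.2.2, (if_neg h).trans hp.symm⟩

theorem OnCommonEdge.symm {x y : G.Realization} (h : OnCommonEdge x y) : OnCommonEdge y x := by
  obtain ⟨u, v, huv, hx, hy⟩ := h
  exact ⟨u, v, huv, hy, hx⟩

theorem pathDist_comm_le (hG : G.Connected) (x y : G.Realization) :
    G.pathDist x y ≤ G.pathDist y x := by
  by_cases h : OnCommonEdge y x
  · rw [pathDist_of_onCommonEdge h, pathDist_of_onCommonEdge h.symm]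
    simp_rw [abs_sub_comm]
    exact le_rfl
  · obtain ⟨u, hu, v, hv, e⟩ := exists_pathDist_eq h
    have := pathDist_le hG x y hv hu
    rw [SimpleGraph.dist_comm] at this
    linarith

theorem pathDist_comm (hG : G.Connected) (x y : G.Realization) :
    G.pathDist x y = G.pathDist y x :=
  le_antisymm (pathDist_comm_le hG x y) (pathDist_comm_le hG y x)

/-- From a point of a closed edge one can pass through any endpoint of this edge. -/
theorem exists_support_le (hG : G.Connected) {x : G.Realization} {a b : V}
    (hab : a = b ∨ G.Adj a b) (hx : x.1 ∈ edgeSegment a b) {u : V} (hu : u = a ∨ u = b) :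
    ∃ u' ∈ x.1.support, ∀ v, (1 - x.1 u') + (G.dist u' v : ℝ) ≤ (1 - x.1 u) + G.dist u v := by
  by_cases h : u ∈ x.1.support
  · exact ⟨u, h, fun v => le_rfl⟩
  · obtain ⟨u', hu'⟩ := x.support_nonempty
    refine ⟨u', hu', fun v => ?_⟩
    have hx0 : x.1 u = 0 := by simpa using h
    have hne : u' ≠ u := fun e => h (e ▸ hu')
    have hadj : G.Adj u' u := by
      rcases edge_of_mem_support hx hu' with rfl | rfl <;> rcases hu with rfl | rfl
      · exact absurd rfl hne
      · exact hab.resolve_left hne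
      · exact (hab.resolve_left hne.symm).symm
      · exact absurd rfl hne
    have h1 : x.1 u' = 1 := by
      obtain ⟨s, t, -, -, hst, e⟩ := mem_edgeSegment hx
      have hcases : (u' = a ∧ u = b) ∨ (u' = b ∧ u = a) := by
        rcases edge_of_mem_support hx hu' with rfl | rfl <;> rcases hu with rfl | rfl <;> simp_all
      classical
      rcases hcases with ⟨rfl, rfl⟩ | ⟨rfl, rfl⟩ <;>
        · simp only [e, Finsupp.add_apply, Finsupp.single_apply] at hx0 ⊢
          simp only [hne, hne.symm, if_true, if_false] at hx0 ⊢
          linarith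
    have hd : G.dist u' v ≤ G.dist u' u + G.dist u v := hG.dist_triangle
    rw [SimpleGraph.dist_eq_one_iff_adj.2 hadj] at hd
    have : (G.dist u' v : ℝ) ≤ 1 + G.dist u v := by exact_mod_cast hd
    linarith

theorem abs_coord_le_of_onCommonEdge {x y : G.Realization} (h : OnCommonEdge x y) (w : V) :
    |x.1 w - y.1 w| ≤ G.pathDist x y := by
  rw [pathDist_of_onCommonEdge h]
  exact le_ciSup (bddAbove_coord x y) w

/-- The triangle inequality when the first two points are on a common edge and the other two
are not. -/
theorem pathDist_triangle_aux (hG : G.Connected) {x y z : G.Realization}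
    (hxy : OnCommonEdge x y) (hyz : ¬ OnCommonEdge y z) :
    G.pathDist x z ≤ G.pathDist x y + G.pathDist y z := by
  obtain ⟨u, hu, v, hv, e⟩ := exists_pathDist_eq hyz
  obtain ⟨a, b, hab, hx, hy⟩ := id hxy
  obtain ⟨u', hu', hle⟩ := exists_support_le hG hab hx (edge_of_mem_support hy hu)
  have h1 := pathDist_le hG x z hu' hv
  have h2 := hle v
  have h3 := (abs_le.1 (abs_coord_le_of_onCommonEdge hxy u)).1
  linarith

/-- A point of two different closed edges is a common endpoint of them. -/
theorem exists_vertex_of_not_onCommonEdge {x y z : G.Realization}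
    (hxy : OnCommonEdge x y) (hyz : OnCommonEdge y z) (hxz : ¬ OnCommonEdge x z) :
    ∃ w, y.1 w = 1 := by
  obtain ⟨a, b, hab, hx, hy⟩ := hxy
  obtain ⟨c, d, hcd, hy', hz⟩ := hyz
  obtain ⟨w, hw⟩ := y.support_nonempty
  by_contra! hne
  have key : ∀ {a b : V}, y.1 ∈ edgeSegment a b → a ∈ y.1.support ∧ b ∈ y.1.support ∧ a ≠ b := by
    classical
    intro a b h
    obtain ⟨s, t, hs, ht, hst, e⟩ := mem_edgeSegment h
    have ha := hne a
    have hb := hne b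
    simp only [Finsupp.mem_support_iff]
    simp only [e, Finsupp.add_apply, Finsupp.single_apply] at ha hb ⊢
    by_cases hab : a = b
    · subst hab
      simp at ha
      exact absurd hst ha
    · simp only [hab, Ne.symm hab, if_true, if_false, add_zero, zero_add] at ha hb ⊢
      refine ⟨fun h0 => hb (by linarith), fun h0 => ha (by linarith), hab⟩
  obtain ⟨ha, hb, hne1⟩ := key hy
  obtain ⟨hc, hd, hne2⟩ := key hy'
  apply hxz
  have h1 := edge_of_mem_support hy hc
  have h2 := edge_of_mem_support hy hd
  refine ⟨a, b, hab, hx, ?_⟩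
  rcases h1 with rfl | rfl <;> rcases h2 with rfl | rfl
  · exact absurd rfl hne2
  · exact hz
  · unfold edgeSegment
    rw [segment_symm]
    exact hz
  · exact absurd rfl hne2

theorem pathDist_triangle (hG : G.Connected) (x y z : G.Realization) :
    G.pathDist x z ≤ G.pathDist x y + G.pathDist y z := by
  by_cases hxy : OnCommonEdge x y <;> by_cases hyz : OnCommonEdge y z
  · by_cases hxz : OnCommonEdge x z
    · rw [pathDist_of_onCommonEdge hxz]
      obtain ⟨u, -⟩ := x.support_nonempty
      have : Nonempty V := ⟨u⟩
      refine ciSup_le fun w => ?_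
      have h1 := abs_coord_le_of_onCommonEdge hxy w
      have h2 := abs_coord_le_of_onCommonEdge hyz w
      have h3 := abs_sub_le (x.1 w) (y.1 w) (z.1 w)
      linarith
    · obtain ⟨w, hw⟩ := exists_vertex_of_not_onCommonEdge hxy hyz hxz
      have hws : w ∈ y.1.support := by simp [hw]
      obtain ⟨a, b, hab, hx, hy⟩ := id hxy
      obtain ⟨c, d, hcd, hy', hz⟩ := id hyz
      obtain ⟨u, hu, hle⟩ := exists_support_le hG hab hx (edge_of_mem_support hy hws)
      obtain ⟨v, hv, hle'⟩ := exists_support_le hG hcd hz (edge_of_mem_support hy' hws)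
      have h1 := pathDist_le hG x z hu hv
      have h2 := hle v
      have h3 := hle' w
      rw [SimpleGraph.dist_comm, SimpleGraph.dist_self] at h3
      have h4 := (abs_le.1 (abs_coord_le_of_onCommonEdge hxy w)).1
      have h5 := (abs_le.1 (abs_coord_le_of_onCommonEdge hyz w)).2
      rw [SimpleGraph.dist_comm] at h3
      simp only [Nat.cast_zero, add_zero] at h3
      rw [SimpleGraph.dist_comm] at h3
      linarith
  · exact pathDist_triangle_aux hG hxy hyz
  · have := pathDist_triangle_aux hG hyz.symm fun h => hxy h.symm
    rw [pathDist_comm hG x z, pathDist_comm hG x y, pathDist_comm hG y z]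
    linarith
  · obtain ⟨u, hu, v, hv, e⟩ := exists_pathDist_eq hxy
    obtain ⟨v', hv', w, hw, e'⟩ := exists_pathDist_eq hyz
    have h1 := pathDist_le hG x z hu hw
    have h2 := dist_le_of_mem_support y hv hv'
    have h3 : (G.dist u w : ℝ) ≤ G.dist u v + G.dist v v' + G.dist v' w := by
      have h4 : G.dist u w ≤ G.dist u v + G.dist v w := hG.dist_triangle
      have h5 : G.dist v w ≤ G.dist v v' + G.dist v' w := hG.dist_triangle
      exact_mod_cast (by omega : G.dist u w ≤ G.dist u v + G.dist v v' + G.dist v' w)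
    linarith

theorem pathDist_self (x : G.Realization) : G.pathDist x x = 0 := by
  have h : OnCommonEdge x x := by
    obtain ⟨u, v, huv, hx⟩ := x.2
    exact ⟨u, v, huv, hx, hx⟩
  rw [pathDist_of_onCommonEdge h]
  simp

theorem eq_of_pathDist_eq_zero (hG : G.Connected) {x y : G.Realization}
    (h : G.pathDist x y = 0) : x = y := by
  apply Subtype.ext
  by_cases hxy : OnCommonEdge x y
  · ext w
    have := abs_coord_le_of_onCommonEdge hxy w
    rw [h] at this
    exact sub_eq_zero.1 (abs_nonpos_iff.1 this)
  · obtain ⟨u, hu, v, hv, e⟩ := exists_pathDist_eq hxy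
    have h1 := x.coord_le u
    have h2 := y.coord_le v
    have h3 : (0 : ℝ) ≤ G.dist u v := Nat.cast_nonneg _
    have h4 : (G.dist u v : ℝ) = 0 := by linarith
    have h5 : u = v := hG.dist_eq_zero_iff.1 (by exact_mod_cast h4)
    subst h5
    rw [x.eq_single (w := u) (by linarith), y.eq_single (w := u) (by linarith)]

end realization

/-- The geometric realization of a connected graph as a metric space. -/
@[reducible] noncomputable def realizationMetricSpace {V : Type*} {G : SimpleGraph V}
    (hG : G.Connected) : MetricSpace G.Realization where
  dist := G.pathDist
  dist_self := pathDist_self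
  dist_comm := pathDist_comm hG
  dist_triangle := pathDist_triangle hG
  eq_of_dist_eq_zero := eq_of_pathDist_eq_zero hG

/-- A graph is hyperbolic if it is connected and its geometric realization, with the path metric
in which every edge has length `1`, is Gromov hyperbolic. -/
def IsHyperbolic {V : Type*} (G : SimpleGraph V) : Prop :=
  ∃ hG : G.Connected, @IsGromovHyperbolic G.Realization (realizationMetricSpace hG)

/-! ### Fine graphs and local finiteness -/

/-- The circuits (closed walks of length `> 2` without self-intersection, remembering their base
point and direction) of length at most `n` containing the edge `e`. -/
def circuitsThrough {V : Type*} (X : SimpleGraph V) (e : Sym2 V) (n : ℕ) :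
    Set (Σ u : V, X.Walk u u) :=
  {p | p.2.IsCycle ∧ e ∈ p.2.edges ∧ p.2.length ≤ n}

/-- For every edge `e` and every `n`, there are only finitely many circuits of length at most `n`
containing `e`. -/
def IsFine {V : Type*} (X : SimpleGraph V) : Prop :=
  ∀ e ∈ X.edgeSet, ∀ n : ℕ, (X.circuitsThrough e n).Finite

/-- The number of circuits of length at most `n` containing an edge is bounded by a function
of `n` only. -/
def IsUniformlyFine {V : Type*} (X : SimpleGraph V) : Prop :=
  ∃ f : ℕ → ℕ, ∀ e ∈ X.edgeSet, ∀ n : ℕ, (X.circuitsThrough e n).encard ≤ f n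

/-- Every vertex has finitely many neighbours. -/
def IsLocallyFinite {V : Type*} (X : SimpleGraph V) : Prop :=
  ∀ v : V, (X.neighborSet v).Finite

/-- The valencies are finite and bounded by one constant. -/
def IsUniformlyLocallyFinite {V : Type*} (X : SimpleGraph V) : Prop :=
  ∃ C : ℕ, ∀ v : V, (X.neighborSet v).encard ≤ C

end SimpleGraph

/-! Everything rests on hyperplanes. An edge labelled `v` at `x` is dual to a hyperplane determined
by `v` and the coset of `x` modulo the star subgroup of `v`. The cocycle obtained from `sectorHom`
assigns to each vertex `x` and hyperplane `J` a sector in `G J.1`, and crossing an edge changes the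
sector of its dual hyperplane and of no other. A geodesic never crosses a hyperplane twice: between
two crossings the word lies in a star subgroup, so the two crossing letters can be merged. Hence
distance counts separating hyperplanes (`exists_finset_separating`).

For (1), the hyperplanes obstructing one of the two comparisons in the four point condition are all
transverse to those obstructing the other, because non-transverse hyperplanes are nested
(`exists_nested`). Two obstructions on each side would give, after making labels distinct
(`exists_transverse_labels_ne`), a 4-cycle in `Γ`. So one comparison has at most one obstruction,
and it holds up to 2 (`dist_add_dist_le`). Passing to the realization costs a further bounded error.

For (2) and (3), the labels of a circuit span a connected subgraph of `Γ` (`label_mem_of_isCycle`).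
Otherwise, separate them into two parts with no edge between them and map the graph product to a
free product of two copies of itself; the normal form there produces a proper subpath of the circuit
that closes up. So all labels of a circuit of length at most `n` through `e` lie in a ball of radius
`n` around the label of `e`, and the circuit is determined by one position and `n` letters from that
ball. -/

namespace GraphProduct

/-! ### Words, geodesic words and star subgroups -/

section basics

variable {V : Type*} {Γ : SimpleGraph V} {G : V → Type*} [∀ v, Group (G v)]

theorem of_commute {v w : V} (h : Γ.Adj v w) (a : G v) (b : G w) :
    Commute (of Γ G v a) (of Γ G w b) := by
  have h1 : (Monoid.CoprodI.of a * Monoid.CoprodI.of b *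
      (Monoid.CoprodI.of a)⁻¹ * (Monoid.CoprodI.of b)⁻¹ : Monoid.CoprodI G) ∈ relations Γ G :=
    Subgroup.subset_normalClosure ⟨v, w, a, b, h, rfl⟩
  have h2 := (QuotientGroup.eq_one_iff _).2 h1
  rw [QuotientGroup.mk_mul, QuotientGroup.mk_inv, mul_inv_eq_one, QuotientGroup.mk_mul,
    QuotientGroup.mk_mul, QuotientGroup.mk_inv, mul_inv_eq_iff_eq_mul] at h2
  exact h2

/-- The universal property of the graph product. -/
def lift {H : Type*} [Group H] (f : ∀ v, G v →* H)
    (hf : ∀ v w, Γ.Adj v w → ∀ a b, Commute (f v a) (f w b)) : GraphProduct Γ G →* H :=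
  QuotientGroup.lift (relations Γ G) (Monoid.CoprodI.lift f) (by
    intro x hx
    have hle : relations Γ G ≤ (Monoid.CoprodI.lift f).ker := by
      refine Subgroup.normalClosure_le_normal ?_
      rintro _ ⟨v, w, a, b, h, rfl⟩
      have hc : f v a * f w b = f w b * f v a := hf v w h a b
      simp [MonoidHom.mem_ker, hc]
    exact hle hx)

@[simp]
theorem lift_of {H : Type*} [Group H] (f : ∀ v, G v →* H)
    (hf : ∀ v w, Γ.Adj v w → ∀ a b, Commute (f v a) (f w b)) (v : V) (a : G v) :
    lift f hf (of Γ G v a) = f v a := by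
  change QuotientGroup.lift _ _ _ (QuotientGroup.mk _) = _
  rw [QuotientGroup.lift_mk, Monoid.CoprodI.lift_of]

/-- The element represented by a word in the vertex groups. -/
def wordProd (Γ : SimpleGraph V) (l : List (Σ v, G v)) : GraphProduct Γ G :=
  (l.map fun s => of Γ G s.1 s.2).prod

@[simp] theorem wordProd_nil : wordProd Γ ([] : List (Σ v, G v)) = 1 := rfl

@[simp] theorem wordProd_cons (s : Σ v, G v) (l : List (Σ v, G v)) :
    wordProd Γ (s :: l) = of Γ G s.1 s.2 * wordProd Γ l := by simp [wordProd]

@[simp] theorem wordProd_append (l l' : List (Σ v, G v)) :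
    wordProd Γ (l ++ l') = wordProd Γ l * wordProd Γ l' := by simp [wordProd]

theorem exists_wordProd_eq (x : GraphProduct Γ G) : ∃ l : List (Σ v, G v), wordProd Γ l = x := by
  induction x using QuotientGroup.induction_on with
  | H z =>
    induction z using Monoid.CoprodI.induction_on with
    | one => exact ⟨[], rfl⟩
    | of v a => exact ⟨[⟨v, a⟩], by simp [wordProd]; rfl⟩
    | mul x y hx hy =>
      obtain ⟨l, hl⟩ := hx
      obtain ⟨l', hl'⟩ := hy
      exact ⟨l ++ l', by rw [wordProd_append, hl, hl']; rfl⟩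

theorem induction_right {p : GraphProduct Γ G → Prop} (x₀ : GraphProduct Γ G) (h0 : p x₀)
    (hs : ∀ x v a, p x → p (x * of Γ G v a)) (x : GraphProduct Γ G) : p x := by
  obtain ⟨l, hl⟩ := exists_wordProd_eq (x₀⁻¹ * x)
  obtain rfl : x = x₀ * wordProd Γ l := by rw [hl]; group
  clear hl
  induction l generalizing x₀ with
  | nil => simpa using h0
  | cons s l ih =>
    rw [wordProd_cons, ← mul_assoc]
    exact ih _ (hs _ _ _ h0)

theorem hom_ext {H : Type*} [Group H] {f g : GraphProduct Γ G →* H}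
    (h : ∀ v a, f (of Γ G v a) = g (of Γ G v a)) : f = g := by
  refine MonoidHom.ext fun x => ?_
  refine induction_right (p := fun x => f x = g x) 1 (by simp) (fun x v a ih => ?_) x
  rw [map_mul, map_mul, ih, h]

theorem cayleyGraph_adj_iff {x y : GraphProduct Γ G} :
    (cayleyGraph Γ G).Adj x y ↔ x ≠ y ∧ ∃ v a, y = x * of Γ G v a := by
  rw [cayleyGraph, SimpleGraph.mulCayley_adj']
  refine and_congr_right fun hne => ⟨?_, ?_⟩
  · rintro ⟨g, hg, h⟩
    simp only [syllables, Set.mem_iUnion, Set.mem_image] at hg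
    obtain ⟨v, a, -, rfl⟩ := hg
    rcases h with h | h
    · exact ⟨v, a, h.symm⟩
    · exact ⟨v, a⁻¹, by rw [h, map_inv]; group⟩
  · rintro ⟨v, a, rfl⟩
    refine ⟨of Γ G v a, ?_, Or.inl rfl⟩
    simp only [syllables, Set.mem_iUnion, Set.mem_image]
    refine ⟨v, a, ?_, rfl⟩
    rintro rfl
    simp at hne

theorem exists_walk_wordProd (x : GraphProduct Γ G) (l : List (Σ v, G v)) :
    ∃ p : (cayleyGraph Γ G).Walk x (x * wordProd Γ l), p.length ≤ l.length := by
  induction l generalizing x with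
  | nil => exact ⟨SimpleGraph.Walk.nil.copy rfl (by simp), by rw [SimpleGraph.Walk.length_copy]; simp⟩
  | cons s l ih =>
    obtain ⟨p, hp⟩ := ih (x * of Γ G s.1 s.2)
    by_cases h : x = x * of Γ G s.1 s.2
    · refine ⟨p.copy h.symm (by simp [mul_assoc]), ?_⟩
      simp
      omega
    · refine ⟨(SimpleGraph.Walk.cons (cayleyGraph_adj_iff.2 ⟨h, _, _, rfl⟩) p).copy rfl
        (by simp [mul_assoc]), ?_⟩
      simpa using hp

theorem exists_word_of_walk {x y : GraphProduct Γ G} (p : (cayleyGraph Γ G).Walk x y) :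
    ∃ l : List (Σ v, G v), x * wordProd Γ l = y ∧ l.length = p.length := by
  induction p with
  | nil => exact ⟨[], by simp⟩
  | cons h p ih =>
    obtain ⟨l, hl, hlen⟩ := ih
    obtain ⟨-, v, a, rfl⟩ := cayleyGraph_adj_iff.1 h
    exact ⟨⟨v, a⟩ :: l, by rw [← hl]; simp [mul_assoc], by simp [hlen]⟩

theorem cayleyGraph_connected : (cayleyGraph Γ G).Connected := by
  rw [SimpleGraph.connected_iff]
  refine ⟨fun x y => ?_, ⟨1⟩⟩
  obtain ⟨l, hl⟩ := exists_wordProd_eq (x⁻¹ * y)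
  obtain ⟨p, -⟩ := exists_walk_wordProd x l
  rw [hl, mul_inv_cancel_left] at p
  exact ⟨p⟩

/-- A word is geodesic if no shorter word represents the same element. -/
def IsGeodesicWord (Γ : SimpleGraph V) (l : List (Σ v, G v)) : Prop :=
  ∀ l' : List (Σ v, G v), wordProd Γ l' = wordProd Γ l → l.length ≤ l'.length

theorem exists_geodesicWord (x y : GraphProduct Γ G) :
    ∃ l : List (Σ v, G v), IsGeodesicWord Γ l ∧ x * wordProd Γ l = y ∧
      l.length = (cayleyGraph Γ G).dist x y := by
  obtain ⟨p, hp⟩ := cayleyGraph_connected.exists_walk_length_eq_dist x y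
  obtain ⟨l, hl, hlen⟩ := exists_word_of_walk p
  refine ⟨l, fun l' hl' => ?_, hl, hlen.trans hp⟩
  obtain ⟨q, hq⟩ := exists_walk_wordProd x l'
  have h : (cayleyGraph Γ G).dist x (x * wordProd Γ l') ≤ l'.length :=
    (SimpleGraph.dist_le q).trans hq
  rwa [hl', hl, ← hp, ← hlen] at h

theorem IsGeodesicWord.of_cons {s : Σ v, G v} {l : List (Σ v, G v)}
    (h : IsGeodesicWord Γ (s :: l)) : IsGeodesicWord Γ l := fun l' hl' => by
  simpa using h (s :: l') (by simp [hl'])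

theorem IsGeodesicWord.ne_one {s : Σ v, G v} {l : List (Σ v, G v)}
    (h : IsGeodesicWord Γ (s :: l)) : s.2 ≠ 1 := fun hs => by
  simpa using h l (by simp [hs])

open Classical in
/-- The endomorphism of the graph product killing the vertex group `G v`. -/
noncomputable def kill (Γ : SimpleGraph V) (G : V → Type*) [∀ v, Group (G v)] (v : V) :
    GraphProduct Γ G →* GraphProduct Γ G :=
  lift (fun u => if u = v then 1 else of Γ G u) (by
    intro u w h a b
    split_ifs
    · exact Commute.one_left _
    · exact Commute.one_left _
    · exact Commute.one_right _
    · exact of_commute h a b)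

theorem kill_of_self (v : V) (a : G v) : kill Γ G v (of Γ G v a) = 1 := by simp [kill]

theorem kill_of_ne {u v : V} (h : u ≠ v) (a : G u) : kill Γ G v (of Γ G u a) = of Γ G u a := by
  simp [kill, h]

open Classical in
theorem kill_wordProd (v : V) (l : List (Σ v, G v)) :
    kill Γ G v (wordProd Γ l) = wordProd Γ (l.filter fun s => s.1 ≠ v) := by
  induction l with
  | nil => simp
  | cons s l ih =>
    obtain ⟨u, a⟩ := s
    by_cases h : u = v
    · subst h
      simp [kill_of_self, ih]
    · simp [h, ih, kill_of_ne]

/-- The subgroup generated by the vertex groups of the star of `v`. -/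
def star (Γ : SimpleGraph V) (G : V → Type*) [∀ v, Group (G v)] (v : V) :
    Subgroup (GraphProduct Γ G) :=
  Subgroup.closure {x | ∃ u a, (u = v ∨ Γ.Adj v u) ∧ x = of Γ G u a}

theorem of_mem_star {u v : V} (h : u = v ∨ Γ.Adj v u) (a : G u) : of Γ G u a ∈ star Γ G v :=
  Subgroup.subset_closure ⟨u, a, h, rfl⟩

/-- The star subgroup is the product of `G v` with the subgroup of the link, which centralizes `G
v`. Invariance of `k` under `kill` later allows a word for `k` to be obtained by deleting the
letters labelled `v`. -/
theorem exists_eq_mul_of_mem_star {v : V} {x : GraphProduct Γ G} (hx : x ∈ star Γ G v) :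
    ∃ (g : G v) (k : GraphProduct Γ G), x = of Γ G v g * k ∧ kill Γ G v k = k ∧
      ∀ a, Commute (of Γ G v a) k := by
  induction hx using Subgroup.closure_induction with
  | mem x hx =>
    obtain ⟨u, a, rfl | h, rfl⟩ := hx
    · exact ⟨a, 1, by simp, by simp, fun _ => Commute.one_right _⟩
    · exact ⟨1, of Γ G u a, by simp, kill_of_ne h.ne' a, fun b => of_commute h b a⟩
  | one => exact ⟨1, 1, by simp, by simp, fun _ => Commute.one_right _⟩
  | mul x y _ _ hx hy =>
    obtain ⟨g, k, rfl, hk, hc⟩ := hx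
    obtain ⟨g', k', rfl, hk', hc'⟩ := hy
    refine ⟨g * g', k * k', ?_, by rw [map_mul, hk, hk'], fun a => (hc a).mul_right (hc' a)⟩
    rw [map_mul, mul_assoc, mul_assoc, ← mul_assoc k, ← (hc g').eq, mul_assoc]
  | inv x _ hx =>
    obtain ⟨g, k, rfl, hk, hc⟩ := hx
    refine ⟨g⁻¹, k⁻¹, ?_, by rw [map_inv, hk], fun a => (hc a).inv_right⟩
    rw [(hc g).eq, mul_inv_rev, map_inv]

end basics

/-! ### Hyperplanes and their sectors -/

section hyperplanes

variable {V : Type*} {Γ : SimpleGraph V} {G : V → Type*} [∀ v, Group (G v)]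

/-- The hyperplanes of the Cayley graph. The carrier of a hyperplane labelled `v` is a coset of the
star subgroup of `v`. -/
abbrev Hyperplane (Γ : SimpleGraph V) (G : V → Type*) [∀ v, Group (G v)] : Type _ :=
  Σ v : V, GraphProduct Γ G ⧸ star Γ G v

/-- The hyperplane dual to the edges labelled `v` at the vertex `x`. -/
def hyp (v : V) (x : GraphProduct Γ G) : Hyperplane Γ G := ⟨v, QuotientGroup.mk x⟩

theorem hyp_eq_iff {v : V} {x y : GraphProduct Γ G} :
    (hyp v x : Hyperplane Γ G) = hyp v y ↔ x⁻¹ * y ∈ star Γ G v := by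
  simp [hyp, QuotientGroup.eq]

theorem exists_hyp_eq (J : Hyperplane Γ G) : ∃ x, J = hyp J.1 x := by
  obtain ⟨v, q⟩ := J
  induction q using QuotientGroup.induction_on with
  | H x => exact ⟨x, rfl⟩

open Classical in
/-- The homomorphism recording the sectors of all hyperplanes labelled `v`. -/
noncomputable def sectorHom (Γ : SimpleGraph V) (G : V → Type*) [∀ v, Group (G v)] (v : V) :
    GraphProduct Γ G →*
      ((GraphProduct Γ G ⧸ star Γ G v) → G v) ⋊[mulAutArrow] GraphProduct Γ G :=
  -- The star subgroup stabilizes the trivial coset, hence fixes functions supported there. This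
  -- makes the assignment multiplicative on `G v` and compatible with the commutation relations.
  have key : ∀ (k : GraphProduct Γ G) (_ : k ∈ star Γ G v) (a : G v),
      (mulAutArrow k (Pi.mulSingle ((1 : GraphProduct Γ G) : GraphProduct Γ G ⧸ star Γ G v) a)) =
        Pi.mulSingle ((1 : GraphProduct Γ G) : GraphProduct Γ G ⧸ star Γ G v) a := by
    intro k hk a
    ext q
    change (Pi.mulSingle ((1 : GraphProduct Γ G) : GraphProduct Γ G ⧸ star Γ G v) a :
      (GraphProduct Γ G ⧸ star Γ G v) → G v) (k⁻¹ • q) = _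
    have hiff : k⁻¹ • q = ((1 : GraphProduct Γ G) : GraphProduct Γ G ⧸ star Γ G v) ↔
        q = ((1 : GraphProduct Γ G) : GraphProduct Γ G ⧸ star Γ G v) := by
      rw [inv_smul_eq_iff, MulAction.Quotient.smul_coe, smul_eq_mul, mul_one,
        show ((k : GraphProduct Γ G) : GraphProduct Γ G ⧸ star Γ G v) = (1 : GraphProduct Γ G) from
          QuotientGroup.eq.2 (by simpa using hk)]
    by_cases h : q = ((1 : GraphProduct Γ G) : GraphProduct Γ G ⧸ star Γ G v)
    · rw [hiff.2 h, h]
    · rw [Pi.mulSingle_eq_of_ne h, Pi.mulSingle_eq_of_ne (fun e => h (hiff.1 e))]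
  lift (fun u => if h : u = v then
      { toFun := fun a => ⟨Pi.mulSingle ((1 : GraphProduct Γ G) : GraphProduct Γ G ⧸ star Γ G v)
          (h ▸ a), of Γ G u a⟩
        map_one' := by subst h; simp
        map_mul' := by
          subst h
          intro a b
          ext1
          · rw [SemidirectProduct.mul_left, key _ (of_mem_star (Or.inl rfl) a), ← Pi.mulSingle_mul]
          · simp }
      else SemidirectProduct.inr.comp (of Γ G u)) (by
    intro u w huw a b
    by_cases hu : u = v <;> by_cases hw : w = v
    · subst hu hw
      exact absurd huw (Γ.irrefl)
    · subst hu
      simp only [dif_pos, dif_neg hw]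
      ext1
      · simp [key _ (of_mem_star (Or.inr huw) b)]
      · simpa using (of_commute huw a b).eq
    · subst hw
      simp only [dif_pos, dif_neg hu]
      ext1
      · simp [key _ (of_mem_star (Or.inr huw.symm) a)]
      · simpa using (of_commute huw a b).eq
    · simp only [dif_neg hu, dif_neg hw]
      exact (of_commute huw a b).map SemidirectProduct.inr)

theorem sectorHom_of_ne {u v : V} (h : u ≠ v) (a : G u) :
    sectorHom Γ G v (of Γ G u a) = SemidirectProduct.inr (of Γ G u a) := by
  simp [sectorHom, h]

open Classical in
theorem sectorHom_of_self (v : V) (a : G v) :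
    sectorHom Γ G v (of Γ G v a) =
      ⟨Pi.mulSingle ((1 : GraphProduct Γ G) : GraphProduct Γ G ⧸ star Γ G v) a, of Γ G v a⟩ := by
  simp [sectorHom]

/-- Both sides are homomorphisms agreeing on letters. Consequently the left component is a cocycle:
right multiplication of `x` by a letter changes it by the `x`-translate of the value at that letter.
-/
theorem sectorHom_right (v : V) (x : GraphProduct Γ G) : (sectorHom Γ G v x).right = x := by
  have h : SemidirectProduct.rightHom.comp (sectorHom Γ G v) = MonoidHom.id _ := by
    refine hom_ext fun u a => ?_
    by_cases h : u = v
    · subst h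
      simp [sectorHom_of_self]
    · simp [sectorHom_of_ne h]
  exact DFunLike.congr_fun h x

/-- The sector of the hyperplane `J` that contains `x`. -/
noncomputable def sector (x : GraphProduct Γ G) (J : Hyperplane Γ G) : G J.1 :=
  (sectorHom Γ G J.1 x).left J.2

theorem sector_mul_of_self (x : GraphProduct Γ G) {v : V} {a : G v} (ha : a ≠ 1) :
    sector (x * of Γ G v a) (hyp v x) ≠ sector x (hyp v x) := by
  classical
  change (sectorHom Γ G v (x * of Γ G v a)).left (x : GraphProduct Γ G ⧸ star Γ G v) ≠
    (sectorHom Γ G v x).left (x : GraphProduct Γ G ⧸ star Γ G v)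
  rw [map_mul, SemidirectProduct.mul_left, sectorHom_right, sectorHom_of_self, Pi.mul_apply,
    ne_eq, mul_eq_left]
  change (Pi.mulSingle ((1 : GraphProduct Γ G) : GraphProduct Γ G ⧸ star Γ G v) a :
      (GraphProduct Γ G ⧸ star Γ G v) → G v) (x⁻¹ • (x : GraphProduct Γ G ⧸ star Γ G v)) ≠ 1
  rwa [MulAction.Quotient.smul_coe, smul_eq_mul, inv_mul_cancel, Pi.mulSingle_eq_same]

/-- The cocycle of a letter labelled `v` is supported on the trivial coset, so its translate by `x`
is supported on the coset of `x`; for other labels the cocycle is trivial. -/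
theorem sector_mul_of_ne {x : GraphProduct Γ G} {v : V} {J : Hyperplane Γ G} (h : J ≠ hyp v x)
    (a : G v) : sector (x * of Γ G v a) J = sector x J := by
  classical
  obtain ⟨u, q⟩ := J
  simp only [sector, map_mul, SemidirectProduct.mul_left, sectorHom_right, Pi.mul_apply]
  by_cases hv : v = u
  · subst hv
    have hq : x⁻¹ • q ≠ ((1 : GraphProduct Γ G) : GraphProduct Γ G ⧸ star Γ G v) := by
      intro e
      apply h
      rw [inv_smul_eq_iff, MulAction.Quotient.smul_coe, smul_eq_mul, mul_one] at e
      rw [hyp, e]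
    rw [sectorHom_of_self]
    change _ * (Pi.mulSingle ((1 : GraphProduct Γ G) : GraphProduct Γ G ⧸ star Γ G v) a :
      (GraphProduct Γ G ⧸ star Γ G v) → G v) (x⁻¹ • q) = _
    rw [Pi.mulSingle_eq_of_ne hq, mul_one]
  · rw [sectorHom_of_ne hv]
    simp

end hyperplanes

end GraphProduct

namespace GraphProduct

/-! ### Separating hyperplanes, transversality and the four point condition -/

section hyperbolicity

variable {V : Type*} {Γ : SimpleGraph V} {G : V → Type*} [∀ v, Group (G v)]

theorem eq_hyp_of_sector_ne {x : GraphProduct Γ G} {v : V} {a : G v} {J : Hyperplane Γ G}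
    (h : sector x J ≠ sector (x * of Γ G v a) J) : J = hyp v x := by
  by_contra hne
  exact h (sector_mul_of_ne hne a).symm

/-- The hyperplanes crossed by the path starting at `x` and labelled by a word. -/
def crossed (Γ : SimpleGraph V) : GraphProduct Γ G → List (Σ v, G v) → List (Hyperplane Γ G)
  | _, [] => []
  | x, s :: l => hyp s.1 x :: crossed Γ (x * of Γ G s.1 s.2) l

theorem length_crossed (x : GraphProduct Γ G) (l : List (Σ v, G v)) :
    (crossed Γ x l).length = l.length := by
  induction l generalizing x with
  | nil => rfl
  | cons s l ih => simp [crossed, ih]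

theorem exists_mem_crossed (x : GraphProduct Γ G) {l : List (Σ v, G v)} {s : Σ v, G v}
    (hs : s ∈ l) : ∃ J ∈ crossed Γ x l, J.1 = s.1 := by
  induction l generalizing x with
  | nil => simp at hs
  | cons t l ih =>
    rcases List.mem_cons.1 hs with rfl | hs
    · exact ⟨_, List.mem_cons_self, rfl⟩
    · obtain ⟨J, hJ, e⟩ := ih (x * of Γ G t.1 t.2) hs
      exact ⟨J, List.mem_cons_of_mem _ hJ, e⟩

theorem exists_append_of_mem_crossed {x : GraphProduct Γ G} {l : List (Σ v, G v)}
    {J : Hyperplane Γ G} (h : J ∈ crossed Γ x l) :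
    ∃ l₁ a l₂, l = l₁ ++ ⟨J.1, a⟩ :: l₂ ∧ J = hyp J.1 (x * wordProd Γ l₁) := by
  induction l generalizing x with
  | nil => simp [crossed] at h
  | cons s l ih =>
    rcases List.mem_cons.1 h with rfl | h
    · exact ⟨[], s.2, l, rfl, by simp [hyp]⟩
    · obtain ⟨l₁, a, l₂, rfl, e⟩ := ih h
      refine ⟨s :: l₁, a, l₂, rfl, ?_⟩
      rwa [wordProd_cons, ← mul_assoc]

/-- A second crossing would put the intermediate word in the star subgroup, as `g * k` with `k`
commuting with `G v`. The two crossing letters and `g` then merge into one letter. -/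
theorem IsGeodesicWord.hyp_notMem_crossed {x : GraphProduct Γ G} {s : Σ v, G v}
    {l : List (Σ v, G v)} (h : IsGeodesicWord Γ (s :: l)) :
    hyp s.1 x ∉ crossed Γ (x * of Γ G s.1 s.2) l := by
  classical
  intro hmem
  obtain ⟨l₁, b, l₂, rfl, e⟩ := exists_append_of_mem_crossed hmem
  obtain ⟨v, a⟩ := s
  change G v at b
  change IsGeodesicWord Γ (⟨v, a⟩ :: (l₁ ++ ⟨v, b⟩ :: l₂)) at h
  rw [show (hyp v x : Hyperplane Γ G).1 = v from rfl, hyp_eq_iff, ← mul_assoc, ← mul_assoc,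
    inv_mul_cancel, one_mul] at e
  have hstar : wordProd Γ l₁ ∈ star Γ G v :=
    (Subgroup.mul_mem_cancel_left _ (of_mem_star (Or.inl rfl) a)).1 e
  obtain ⟨g, k, hgk, hk, hc⟩ := exists_eq_mul_of_mem_star hstar
  have hkl : wordProd Γ (l₁.filter fun s => s.1 ≠ v) = k := by
    rw [← kill_wordProd, hgk, map_mul, kill_of_self, hk, one_mul]
  -- `a g k b = (a g b) k`, where `k` is spelled by `l₁` without its `v`-letters; this saves at
  -- least one letter.
  have h1 := h (⟨v, a * g * b⟩ :: (l₁.filter fun s => s.1 ≠ v) ++ l₂) (by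
    simp only [List.cons_append, wordProd_cons, wordProd_append, hkl, hgk, map_mul]
    simp only [mul_assoc]
    rw [← mul_assoc k, ← (hc b).eq]
    simp only [mul_assoc])
  have h2 := List.length_filter_le (fun s : Σ v, G v => decide (s.1 ≠ v)) l₁
  simp at h1 h2
  omega

theorem IsGeodesicWord.nodup_crossed {x : GraphProduct Γ G} {l : List (Σ v, G v)}
    (h : IsGeodesicWord Γ l) : (crossed Γ x l).Nodup := by
  induction l generalizing x with
  | nil => exact List.nodup_nil
  | cons s l ih => exact List.nodup_cons.2 ⟨h.hyp_notMem_crossed, ih h.of_cons⟩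

theorem mem_crossed_of_sector_ne {x : GraphProduct Γ G} {l : List (Σ v, G v)}
    {J : Hyperplane Γ G} (h : sector x J ≠ sector (x * wordProd Γ l) J) : J ∈ crossed Γ x l := by
  induction l generalizing x with
  | nil => simp at h
  | cons s l ih =>
    by_cases hs : sector x J = sector (x * of Γ G s.1 s.2) J
    · refine List.mem_cons_of_mem _ (ih ?_)
      rwa [← hs, mul_assoc, ← wordProd_cons]
    · rw [eq_hyp_of_sector_ne hs]
      exact List.mem_cons_self

theorem IsGeodesicWord.mem_crossed_iff {x : GraphProduct Γ G} {l : List (Σ v, G v)}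
    (hl : IsGeodesicWord Γ l) {J : Hyperplane Γ G} :
    J ∈ crossed Γ x l ↔ sector x J ≠ sector (x * wordProd Γ l) J := by
  refine ⟨fun h => ?_, mem_crossed_of_sector_ne⟩
  induction l generalizing x with
  | nil => simp [crossed] at h
  | cons s l ih =>
    rcases List.mem_cons.1 h with rfl | hJ
    · intro e
      -- The first letter changes this sector; if the endpoints agreed, the tail would have to
      -- change it back, hence cross the hyperplane again.
      apply hl.hyp_notMem_crossed (x := x)
      refine mem_crossed_of_sector_ne fun e' => ?_
      rw [mul_assoc, ← wordProd_cons, ← e] at e'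
      exact sector_mul_of_self x hl.ne_one e'
    · have hne : J ≠ hyp s.1 x := fun e => hl.hyp_notMem_crossed (e ▸ hJ)
      have := ih hl.of_cons hJ
      rwa [sector_mul_of_ne hne, mul_assoc, ← wordProd_cons] at this

/-- The distance of two vertices is the number of hyperplanes separating them. -/
theorem exists_finset_separating (x y : GraphProduct Γ G) :
    ∃ S : Finset (Hyperplane Γ G), (∀ J, J ∈ S ↔ sector x J ≠ sector y J) ∧
      S.card = (cayleyGraph Γ G).dist x y := by
  classical
  obtain ⟨l, hl, rfl, hlen⟩ := exists_geodesicWord x y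
  refine ⟨(crossed Γ x l).toFinset, fun J => ?_, ?_⟩
  · rw [List.mem_toFinset, hl.mem_crossed_iff]
  · rw [List.toFinset_card_of_nodup hl.nodup_crossed, length_crossed, hlen]

/-- A hyperplane separating two points of the carrier of a hyperplane labelled `w` meets
this carrier, and its label is in the star of `w`. -/
theorem exists_eq_hyp_of_sector_ne {w : V} {x y : GraphProduct Γ G}
    (hxy : (hyp w x : Hyperplane Γ G) = hyp w y) {J : Hyperplane Γ G}
    (h : sector x J ≠ sector y J) :
    ∃ z, (hyp w z : Hyperplane Γ G) = hyp w x ∧ J = hyp J.1 z ∧ (J.1 = w ∨ Γ.Adj w J.1) := by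
  rw [hyp_eq_iff] at hxy
  obtain ⟨t, rfl⟩ : ∃ t, y = x * t := ⟨x⁻¹ * y, by group⟩
  rw [inv_mul_cancel_left] at hxy
  induction hxy using Subgroup.closure_induction generalizing x with
  | mem t ht =>
    obtain ⟨u, a, hu, rfl⟩ := ht
    obtain rfl := eq_hyp_of_sector_ne h
    exact ⟨x, rfl, rfl, hu⟩
  | one => simp at h
  | mul s t hs ht ihs iht =>
    -- `J` separates the intermediate point `x * s` from one of the two ends.
    by_cases hx : sector x J = sector (x * s) J
    · rw [hx, ← mul_assoc] at h
      obtain ⟨z, hz, hz'⟩ := iht h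
      refine ⟨z, hz.trans ?_, hz'⟩
      rw [hyp_eq_iff, mul_inv_rev, inv_mul_cancel_right]
      exact inv_mem hs
    · exact ihs hx
  | inv t ht ih =>
    obtain ⟨z, hz, hz'⟩ := ih (x := x * t⁻¹) (by simpa using h.symm)
    refine ⟨z, hz.trans ?_, hz'⟩
    rw [hyp_eq_iff, mul_inv_rev, inv_mul_cancel_right, inv_inv]
    exact ht

/-- Two hyperplanes are transverse if their carriers meet and their labels are adjacent. -/
def Transverse (J K : Hyperplane Γ G) : Prop :=
  Γ.Adj J.1 K.1 ∧ ∃ x, J = hyp J.1 x ∧ K = hyp K.1 x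

theorem Transverse.symm {J K : Hyperplane Γ G} (h : Transverse J K) : Transverse K J :=
  ⟨h.1.symm, h.2.imp fun _ => And.symm⟩

/-- If `K` separated two points of the carrier of `J`, it would meet this carrier with a label in
the star of `J.1`: an equal label forces `K = J`, an adjacent one forces transversality. -/
theorem sector_eq_of_not_transverse {J K : Hyperplane Γ G} (hne : J ≠ K) (h : ¬ Transverse J K)
    {x y : GraphProduct Γ G} (hx : J = hyp J.1 x) (hy : J = hyp J.1 y) :
    sector x K = sector y K := by
  by_contra hK
  obtain ⟨z, hz, hz', e | hadj⟩ := exists_eq_hyp_of_sector_ne (hx.symm.trans hy) hK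
  · apply hne
    rw [hx, ← hz, hz', e]
  · exact h ⟨hadj, z, hx.trans hz.symm, hz'⟩

/-- Two distinct hyperplanes that are not transverse are nested. -/
theorem exists_nested {J K : Hyperplane Γ G} (hne : J ≠ K) (h : ¬ Transverse J K) :
    ∃ (a : G J.1) (b : G K.1), ∀ x, sector x J = a ∨ sector x K = b := by
  obtain ⟨x₀, hx₀⟩ := exists_hyp_eq J
  obtain ⟨y₀, hy₀⟩ := exists_hyp_eq K
  -- The sector of `J` containing the carrier of `K`, and vice versa. Along a path the alternative
  -- can only change at an edge dual to `J` or `K`, and such an edge lies in the corresponding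
  -- carrier.
  refine ⟨sector y₀ J, sector x₀ K, induction_right x₀ (Or.inr rfl) fun x v a ih => ?_⟩
  by_cases hJ : J = hyp v x
  · have hv : J.1 = v := congrArg Sigma.fst hJ
    refine Or.inr (sector_eq_of_not_transverse hne h (hJ.trans ?_) hx₀)
    rw [hv, hyp_eq_iff, inv_mul_cancel_left]
    exact of_mem_star (Or.inl rfl) a
  by_cases hK : K = hyp v x
  · have hv : K.1 = v := congrArg Sigma.fst hK
    refine Or.inl (sector_eq_of_not_transverse hne.symm (fun t => h t.symm) (hK.trans ?_) hy₀)
    rw [hv, hyp_eq_iff, inv_mul_cancel_left]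
    exact of_mem_star (Or.inl rfl) a
  rwa [sector_mul_of_ne hJ, sector_mul_of_ne hK]

/-- If two distinct hyperplanes are transverse to `K₁` and `K₂`, then so are two hyperplanes with
distinct labels. -/
theorem exists_transverse_labels_ne {J₁ J₂ K₁ K₂ : Hyperplane Γ G} (hJ : J₁ ≠ J₂)
    (h₁₁ : Transverse J₁ K₁) (h₁₂ : Transverse J₁ K₂) (h₂₁ : Transverse J₂ K₁)
    (h₂₂ : Transverse J₂ K₂) :
    ∃ L₁ L₂ : Hyperplane Γ G, L₁.1 ≠ L₂.1 ∧ Transverse L₁ K₁ ∧ Transverse L₁ K₂ ∧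
      Transverse L₂ K₁ ∧ Transverse L₂ K₂ := by
  by_cases hlab : J₁.1 = J₂.1
  swap
  · exact ⟨J₁, J₂, hlab, h₁₁, h₁₂, h₂₁, h₂₂⟩
  obtain ⟨x₁, hx₁⟩ := exists_hyp_eq J₁
  obtain ⟨x₂, hx₂⟩ := exists_hyp_eq J₂
  rw [← hlab] at hx₂
  obtain ⟨l, hl, hx, -⟩ := exists_geodesicWord x₁ x₂
  have hstar : wordProd Γ l ∉ star Γ G J₁.1 := by
    intro h
    apply hJ
    rw [hx₁, hx₂, hyp_eq_iff, ← hx, inv_mul_cancel_left]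
    exact h
  -- The hyperplane `L` dual to this letter separates the carriers of `J₁` and `J₂`, since its label
  -- outside the star prevents it from separating points of either one. A hyperplane transverse to
  -- both therefore has its carrier cut by `L`.
  obtain ⟨s, hs, hs'⟩ : ∃ s ∈ l, ¬ (s.1 = J₁.1 ∨ Γ.Adj J₁.1 s.1) := by
    by_contra! hall
    refine hstar (Subgroup.list_prod_mem _ fun g hg => ?_)
    obtain ⟨s, hs, rfl⟩ := List.mem_map.1 hg
    exact of_mem_star (hall s hs) s.2
  obtain ⟨L, hL, e⟩ := exists_mem_crossed x₁ hs
  rw [← e] at hs'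
  rw [hl.mem_crossed_iff, hx] at hL
  have hconst : ∀ {x y : GraphProduct Γ G}, (hyp J₁.1 x : Hyperplane Γ G) = hyp J₁.1 y →
      sector x L = sector y L := by
    intro x y hxy
    by_contra hne
    obtain ⟨-, -, -, h⟩ := exists_eq_hyp_of_sector_ne hxy hne
    exact hs' h
  have key : ∀ K, Transverse J₁ K → Transverse J₂ K → Transverse L K := by
    intro K h₁ h₂
    obtain ⟨hadj, y₁, hy₁, hK₁⟩ := h₁
    obtain ⟨-, y₂, hy₂, hK₂⟩ := h₂
    rw [← hlab] at hy₂
    have hsec : sector y₁ L ≠ sector y₂ L := by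
      rwa [hconst (hy₁.symm.trans hx₁), hconst (hy₂.symm.trans hx₂)]
    obtain ⟨z, hz, hz', h⟩ := exists_eq_hyp_of_sector_ne (hK₁.symm.trans hK₂) hsec
    refine ⟨?_, z, hz', hK₁.trans hz.symm⟩
    rcases h with h | h
    · exact absurd (Or.inr (h ▸ hadj)) hs'
    · exact h.symm
  refine ⟨J₁, L, fun h => hs' (Or.inl h.symm), h₁₁, h₁₂, key _ h₁₁ h₂₁, key _ h₁₂ h₂₂⟩

theorem egirth_le_four {v₁ v₂ w₁ w₂ : V} (hv : v₁ ≠ v₂) (hw : w₁ ≠ w₂) (h₁₁ : Γ.Adj v₁ w₁)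
    (h₁₂ : Γ.Adj v₁ w₂) (h₂₁ : Γ.Adj v₂ w₁) (h₂₂ : Γ.Adj v₂ w₂) : Γ.egirth ≤ 4 := by
  let p : Γ.Walk v₁ v₁ := .cons h₁₁ (.cons h₂₁.symm (.cons h₂₂ (.cons h₁₂.symm .nil)))
  have hp : p.IsCycle := by
    rw [SimpleGraph.Walk.isCycle_def, SimpleGraph.Walk.isTrail_def]
    have := h₁₁.ne
    have := h₁₂.ne
    have := h₂₁.ne
    have := h₂₂.ne
    refine ⟨?_, by simp [p], ?_⟩ <;> simp [p] <;> grind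
  simpa [p] using SimpleGraph.egirth_le_length hp

/-- If `Γ` has no squares, one of two families of pairwise transverse hyperplanes is trivial. -/
theorem subsingleton_or_subsingleton (hΓ : 4 < Γ.egirth) {A B : Set (Hyperplane Γ G)}
    (h : ∀ J ∈ A, ∀ K ∈ B, Transverse J K) : A.Subsingleton ∨ B.Subsingleton := by
  by_contra! hcon
  obtain ⟨⟨J₁, hJ₁, J₂, hJ₂, hJ⟩, ⟨K₁, hK₁, K₂, hK₂, hK⟩⟩ := hcon
  obtain ⟨L₁, L₂, hL, h₁₁, h₁₂, h₂₁, h₂₂⟩ := exists_transverse_labels_ne hJ (h _ hJ₁ _ hK₁)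
    (h _ hJ₁ _ hK₂) (h _ hJ₂ _ hK₁) (h _ hJ₂ _ hK₂)
  -- With the roles exchanged: the labels of `M₁`, `M₂` and `L₁`, `L₂` form a square in `Γ`.
  obtain ⟨M₁, M₂, hM, g₁₁, g₁₂, g₂₁, g₂₂⟩ :=
    exists_transverse_labels_ne hK h₁₁.symm h₂₁.symm h₁₂.symm h₂₂.symm
  exact absurd (egirth_le_four hM hL g₁₁.1 g₁₂.1 g₂₁.1 g₂₂.1) (not_le.2 hΓ)

/-- The four point condition for the vertices of the Cayley graph. -/
theorem dist_add_dist_le (hΓ : 4 < Γ.egirth) (w x y z : GraphProduct Γ G) :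
    (cayleyGraph Γ G).dist x z + (cayleyGraph Γ G).dist y w ≤
      max ((cayleyGraph Γ G).dist x y + (cayleyGraph Γ G).dist z w)
        ((cayleyGraph Γ G).dist y z + (cayleyGraph Γ G).dist x w) + 2 := by
  classical
  obtain ⟨Sxz, hxz, exz⟩ := exists_finset_separating x z
  obtain ⟨Syw, hyw, eyw⟩ := exists_finset_separating y w
  obtain ⟨Sxy, hxy, exy⟩ := exists_finset_separating x y
  obtain ⟨Szw, hzw, ezw⟩ := exists_finset_separating z w
  obtain ⟨Syz, hyz, eyz⟩ := exists_finset_separating y z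
  obtain ⟨Sxw, hxw, exw⟩ := exists_finset_separating x w
  set T := Sxz ∪ Syw ∪ Sxy ∪ Szw ∪ Syz ∪ Sxw with hT
  have hcard : ∀ S ⊆ T, S.card = ∑ J ∈ T, if J ∈ S then 1 else 0 := by
    intro S hS
    rw [Finset.sum_ite_mem, Finset.inter_eq_right.2 hS, Finset.card_eq_sum_ones]
  -- Exactly the hyperplanes contributing more to `xz + yw` than to `xy + zw`, the excess being at
  -- most 2. `B` plays this role for `yz + xw`.
  let A : Set (Hyperplane Γ G) := {J | sector x J ≠ sector z J ∧ sector y J ≠ sector w J ∧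
    (sector x J = sector y J ∨ sector z J = sector w J)}
  let B : Set (Hyperplane Γ G) := {J | sector x J ≠ sector z J ∧ sector y J ≠ sector w J ∧
    (sector y J = sector z J ∨ sector x J = sector w J)}
  have hAB : ∀ J ∈ A, ∀ K ∈ B, Transverse J K := by
    rintro J ⟨j1, j2, j3⟩ K ⟨k1, k2, k3⟩
    by_contra hJK
    have hne : J ≠ K := by
      rintro rfl
      grind
    -- One point of each pair `{x, z}`, `{y, w}` lies in the sector `b` of `K`, and the two
    -- remaining points share the sector `a` of `J`. Whichever points these are, `j3` or `k3` fails.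
    obtain ⟨a, b, hab⟩ := exists_nested hne hJK
    have hx := hab x
    have hy := hab y
    have hz := hab z
    have hw := hab w
    grind
  have hbound : ∀ C : Set (Hyperplane Γ G), C.Subsingleton →
      ∑ J ∈ T, (if J ∈ C then 2 else 0) ≤ 2 := by
    intro C hC
    rw [← Finset.sum_filter, Finset.sum_const, smul_eq_mul]
    have : (T.filter (· ∈ C)).card ≤ 1 := Finset.card_le_one.2 fun a ha b hb =>
      hC (Finset.mem_filter.1 ha).2 (Finset.mem_filter.1 hb).2
    omega
  rw [← exz, ← eyw, ← exy, ← ezw, ← eyz, ← exw, hcard Sxz (by grind), hcard Syw (by grind),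
    hcard Sxy (by grind), hcard Szw (by grind), hcard Syz (by grind), hcard Sxw (by grind)]
  simp only [hxz, hyw, hxy, hzw, hyz, hxw, ← Finset.sum_add_distrib]
  rcases subsingleton_or_subsingleton hΓ hAB with h | h
  · refine le_trans ?_ (Nat.add_le_add (le_max_left _ _) (hbound A h))
    rw [← Finset.sum_add_distrib]
    refine Finset.sum_le_sum fun J _ => ?_
    simp only [A, Set.mem_ofPred_eq]
    grind
  · refine le_trans ?_ (Nat.add_le_add (le_max_right _ _) (hbound B h))
    rw [← Finset.sum_add_distrib]
    refine Finset.sum_le_sum fun J _ => ?_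
    simp only [B, Set.mem_ofPred_eq]
    grind

end hyperbolicity

end GraphProduct

/-! ### From vertices to the geometric realization -/

namespace SimpleGraph

/-- Replacing the optimal exit vertex of `x` by `u` costs at most `1 - x u` beyond what the path
already pays, and likewise for `y` and `v`. -/
theorem dist_le_pathDist_add_two {V : Type*} {X : SimpleGraph V} (hX : X.Connected)
    {x y : X.Realization} {u v : V} (hu : u ∈ x.1.support) (hv : v ∈ y.1.support) :
    (X.dist u v : ℝ) ≤ X.pathDist x y + 2 := by
  by_cases h : OnCommonEdge x y
  · have h0 := (abs_nonneg _).trans (abs_coord_le_of_onCommonEdge h u)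
    obtain ⟨a, b, hab, hx, hy⟩ := h
    have h1 : X.dist u v ≤ 1 := by
      by_cases huv : u = v
      · simp [huv]
      · refine (dist_eq_one_iff_adj.2 ?_).le
        have := edge_of_mem_support hx hu
        have := edge_of_mem_support hy hv
        grind [X.adj_comm]
    have h2 : (X.dist u v : ℝ) ≤ 1 := by exact_mod_cast h1
    linarith
  · obtain ⟨u', hu', v', hv', e⟩ := exists_pathDist_eq h
    have h1 := dist_le_of_mem_support x hu hu'
    have h2 := dist_le_of_mem_support y hv' hv
    have h3 := x.coord_nonneg u
    have h4 := y.coord_nonneg v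
    have h5 : (X.dist u v : ℝ) ≤ X.dist u u' + X.dist u' v' + X.dist v' v := by
      have h6 : X.dist u v ≤ X.dist u u' + X.dist u' v := hX.dist_triangle
      have h7 : X.dist u' v ≤ X.dist u' v' + X.dist v' v := hX.dist_triangle
      exact_mod_cast (by omega : X.dist u v ≤ X.dist u u' + X.dist u' v' + X.dist v' v)
    linarith

/-- The four point condition for vertices implies hyperbolicity. -/
theorem isHyperbolic_of_dist_add_dist_le {V : Type*} {X : SimpleGraph V} (hX : X.Connected)
    {c : ℕ} (h : ∀ w x y z : V, X.dist x z + X.dist y w ≤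
      max (X.dist x y + X.dist z w) (X.dist y z + X.dist x w) + c) : X.IsHyperbolic := by
  -- Each of the four distances involved changes by at most 2, so the error is `c + 8`, and Gromov
  -- products halve it.
  refine ⟨hX, c + 4, fun w x y z => ?_⟩
  obtain ⟨w', hw⟩ := w.support_nonempty
  obtain ⟨x', hx⟩ := x.support_nonempty
  obtain ⟨y', hy⟩ := y.support_nonempty
  obtain ⟨z', hz⟩ := z.support_nonempty
  have upper : ∀ {x y : X.Realization} {u v : V}, u ∈ x.1.support → v ∈ y.1.support →
      X.pathDist x y ≤ X.dist u v + 2 := by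
    intro x y u v hu hv
    have := pathDist_le hX x y hu hv
    have := x.coord_nonneg u
    have := y.coord_nonneg v
    linarith
  have h1 := upper hx hz
  have h2 := upper hy hw
  have h3 := dist_le_pathDist_add_two hX hx hy
  have h4 := dist_le_pathDist_add_two hX hz hw
  have h5 := dist_le_pathDist_add_two hX hy hz
  have h6 := dist_le_pathDist_add_two hX hx hw
  have h7 : (X.dist x' z' : ℝ) + X.dist y' w' ≤
      max ((X.dist x' y' : ℝ) + X.dist z' w') (X.dist y' z' + X.dist x' w') + c := by
    exact_mod_cast h w' x' y' z'
  change (X.pathDist x w + X.pathDist z w - X.pathDist x z) / 2 ≥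
    min ((X.pathDist x w + X.pathDist y w - X.pathDist x y) / 2)
      ((X.pathDist y w + X.pathDist z w - X.pathDist y z) / 2) - ((c + 4 : ℕ) : ℝ)
  push_cast
  have hc : (0 : ℝ) ≤ c := Nat.cast_nonneg c
  rw [ge_iff_le, sub_le_iff_le_add, min_le_iff]
  rcases max_cases ((X.dist x' y' : ℝ) + X.dist z' w') (X.dist y' z' + X.dist x' w') with
    ⟨e, -⟩ | ⟨e, -⟩ <;> rw [e] at h7
  · left
    linarith
  · right
    linarith

end SimpleGraph

/-! ### Monochromatic subwords in free products -/

/-- If a word in a free product of two copies of `H` is trivial, then some nonempty subword in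
letters of the same factor is trivial in `H`. -/
theorem Monoid.CoprodI.exists_subword_prod_eq_one {α H : Type*} [Group H] (col : α → Bool)
    (val : α → H) {l : List α} (hl : l ≠ [])
    (h : (l.map fun a => (of (i := col a) (val a) : CoprodI fun _ : Bool => H)).prod = 1) :
    ∃ l₁ b l₂, l = l₁ ++ b ++ l₂ ∧ b ≠ [] ∧ (∀ x ∈ b, ∀ y ∈ b, col x = col y) ∧
      (b.map val).prod = 1 := by
  classical
  let r : α → α → Bool := fun a b => decide (col a = col b)
  have hmono : ∀ b ∈ l.splitBy r, ∀ x ∈ b, ∀ y ∈ b, col x = col y := by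
    intro b hb x hx y hy
    have h1 : (b.map col).IsChain (· = ·) := by
      rw [List.isChain_map]
      exact (List.isChain_of_mem_splitBy hb).imp fun x y hxy => by simpa [r] using hxy
    have h2 := List.isChain_iff_pairwise.1 h1
    exact h2.forall_of_forall (fun _ _ => rfl) (List.mem_map_of_mem hx) (List.mem_map_of_mem hy)
  -- Otherwise the products of the maximal monochromatic blocks form a nonempty reduced word with
  -- product 1, against uniqueness of normal forms.
  by_contra! hcon
  have hne : ∀ b ∈ l.splitBy r, (b.map val).prod ≠ 1 := by
    intro b hb
    obtain ⟨s, t, hst⟩ := List.append_of_mem hb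
    refine hcon s.flatten b t.flatten ?_ (List.ne_nil_of_mem_splitBy hb) (hmono b hb)
    rw [← List.flatten_splitBy r l, hst]
    simp
  -- The default is irrelevant: blocks are nonempty.
  let c : List α → Bool := fun b => (b.head?.map col).getD false
  have hc : ∀ b ∈ l.splitBy r, ∀ x ∈ b, c b = col x := by
    intro b hb x hx
    obtain ⟨y, t, rfl⟩ := List.exists_cons_of_ne_nil (List.ne_nil_of_mem_splitBy hb)
    simpa [c] using hmono _ hb y (by simp) x hx
  let w : Word fun _ : Bool => H :=
    { toList := (l.splitBy r).map fun b => ⟨c b, (b.map val).prod⟩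
      ne_one := by
        intro s hs
        obtain ⟨b, hb, rfl⟩ := List.mem_map.1 hs
        exact hne b hb
      chain_ne := by
        rw [List.isChain_map]
        refine List.IsChain.imp_of_mem_imp (fun a b ha hb hab => ?_)
          (List.isChain_getLast_head_splitBy r l)
        obtain ⟨ha', hb', hab⟩ := hab
        rw [hc a ha _ (List.getLast_mem ha'), hc b hb _ (List.head_mem hb')]
        simpa [r] using hab }
  have hw : w.prod = 1 := by
    rw [← h]
    conv_rhs => rw [← List.flatten_splitBy r l]
    rw [List.map_flatten, List.prod_flatten, List.map_map, Word.prod, List.map_map]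
    congr 1
    refine List.map_congr_left fun b hb => ?_
    simp only [Function.comp_apply]
    rw [map_list_prod, List.map_map]
    congr 1
    refine List.map_congr_left fun x hx => ?_
    simp [hc b hb x hx]
  have hw' : w = Word.empty := Word.equiv.symm.injective (by
    change w.prod = Word.empty.prod
    rw [hw, Word.prod_empty])
  have hnil : (l.splitBy r).map (fun b => (⟨c b, (b.map val).prod⟩ : Σ _ : Bool, H)) = [] :=
    congrArg Word.toList hw'
  exact List.splitBy_ne_nil.2 hl (List.map_eq_nil_iff.1 hnil)

theorem Set.ncard_biUnion_le_ncard_mul {ι α : Type*} {T : Set ι} (hT : T.Finite) {f : ι → Set α}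
    {C : ℕ} (hf : ∀ i ∈ T, (f i).Finite) (hC : ∀ i ∈ T, (f i).ncard ≤ C) :
    (⋃ i ∈ T, f i).ncard ≤ T.ncard * C := by
  classical
  induction T, hT using Set.Finite.induction_on with
  | empty => simp
  | @insert a T ha hT ih =>
    rw [Set.biUnion_insert, Set.ncard_insert_of_notMem ha hT, add_mul, one_mul, add_comm]
    exact (Set.ncard_union_le _ _).trans (Nat.add_le_add (hC a (Set.mem_insert _ _))
      (ih (fun i hi => hf i (Set.mem_insert_of_mem _ hi))
        fun i hi => hC i (Set.mem_insert_of_mem _ hi)))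

/-! ### Balls in `Γ` and walks in graphs on a group -/

namespace SimpleGraph

variable {V : Type*} {Γ : SimpleGraph V}

/-- The vertices that can be reached from `v` by a walk of length at most `n`. -/
def walkBall (Γ : SimpleGraph V) (v : V) (n : ℕ) : Set V :=
  {w | ∃ q : Γ.Walk v w, q.length ≤ n}

theorem walkBall_zero (v : V) : Γ.walkBall v 0 = {v} := by
  ext w
  simp only [walkBall, Set.mem_ofPred_eq, Set.mem_singleton_iff]
  constructor
  · rintro ⟨q, hq⟩
    exact (Walk.eq_of_length_eq_zero (Nat.le_zero.1 hq)).symm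
  · rintro rfl
    exact ⟨.nil, le_rfl⟩

theorem walkBall_succ_subset (v : V) (n : ℕ) :
    Γ.walkBall v (n + 1) ⊆ ⋃ w ∈ Γ.walkBall v n, insert w (Γ.neighborSet w) := by
  rintro w ⟨q, hq⟩
  simp only [Set.mem_iUnion, exists_prop]
  rcases Nat.lt_or_ge n q.length with h | h
  · refine ⟨q.penultimate, ⟨q.dropLast, ?_⟩, Or.inr (q.adj_penultimate ?_)⟩
    · simp
      omega
    · rw [Walk.not_nil_iff_lt_length]
      omega
  · exact ⟨w, ⟨q, h⟩, Set.mem_insert _ _⟩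

theorem IsLocallyFinite.finite_walkBall (h : Γ.IsLocallyFinite) (v : V) (n : ℕ) :
    (Γ.walkBall v n).Finite := by
  induction n with
  | zero => simp [walkBall_zero]
  | succ n ih =>
    exact (ih.biUnion fun w _ => (h w).insert w).subset (walkBall_succ_subset v n)

theorem IsLocallyFinite.ncard_walkBall_le (h : Γ.IsLocallyFinite) {C : ℕ}
    (hC : ∀ v, (Γ.neighborSet v).ncard ≤ C) (v : V) (n : ℕ) :
    (Γ.walkBall v n).ncard ≤ (C + 1) ^ n := by
  induction n with
  | zero => simp [walkBall_zero]
  | succ n ih =>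
    have hfin := h.finite_walkBall v n
    calc (Γ.walkBall v (n + 1)).ncard
        ≤ (⋃ w ∈ Γ.walkBall v n, insert w (Γ.neighborSet w)).ncard :=
          Set.ncard_le_ncard (walkBall_succ_subset v n)
            (hfin.biUnion fun w _ => (h w).insert w)
      _ ≤ (Γ.walkBall v n).ncard * (C + 1) :=
          Set.ncard_biUnion_le_ncard_mul hfin (fun w _ => (h w).insert w) fun w _ =>
            (Set.ncard_insert_le _ _).trans (Nat.add_le_add_right (hC w) 1)
      _ ≤ (C + 1) ^ (n + 1) := by
          rw [pow_succ]
          exact Nat.mul_le_mul_right _ ih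

theorem Walk.getVert_eq_mul_prod {M : Type*} [Group M] {X : SimpleGraph M} {u v : M}
    (p : X.Walk u v) (i : ℕ) :
    p.getVert i = u * ((p.darts.take i).map fun d => d.fst⁻¹ * d.snd).prod := by
  induction p generalizing i with
  | nil => simp
  | cons h p ih =>
    cases i with
    | zero => simp
    | succ i => simp [ih, ← mul_assoc]

end SimpleGraph

/-! ### Labels of circuits and their number -/

namespace GraphProduct

variable {V : Type*} {Γ : SimpleGraph V} {G : V → Type*} [∀ v, Group (G v)]

/-- Vertex groups are closed under inverses, so one label serves both orientations. -/
theorem exists_edge_label (e : Sym2 (GraphProduct Γ G)) (he : e ∈ (cayleyGraph Γ G).edgeSet) :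
    ∃ v, ∀ a b, e = s(a, b) → a⁻¹ * b ∈ (of Γ G v).range := by
  induction e using Sym2.ind with
  | h x y =>
    obtain ⟨-, v, a, rfl⟩ := cayleyGraph_adj_iff.1 ((SimpleGraph.mem_edgeSet _).1 he)
    refine ⟨v, fun b c hbc => ?_⟩
    rcases Sym2.eq_iff.1 hbc with ⟨rfl, rfl⟩ | ⟨rfl, rfl⟩
    · exact ⟨a, by group⟩
    · exact ⟨a⁻¹, by rw [map_inv]; group⟩

/-- The labels of a circuit span a connected subgraph. -/
theorem label_mem_of_isCycle {lab : Sym2 (GraphProduct Γ G) → V}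
    (hlab : ∀ e ∈ (cayleyGraph Γ G).edgeSet, ∀ a b, e = s(a, b) → a⁻¹ * b ∈ (of Γ G (lab e)).range)
    {u : GraphProduct Γ G} {p : (cayleyGraph Γ G).Walk u u} (hp : p.IsCycle)
    {C : Set V} (hC : ∀ v ∈ C, ∀ e ∈ p.edges, Γ.Adj v (lab e) → lab e ∈ C)
    {e e' : Sym2 (GraphProduct Γ G)} (he : e ∈ p.edges) (heC : lab e ∈ C) (he' : e' ∈ p.edges) :
    lab e' ∈ C := by
  classical
  let S : Set V := {v | ∃ e ∈ p.edges, lab e = v}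
  -- Vertex groups off the circuit are killed; the others go to one of two free factors according to
  -- membership in `C`. By `hC`, adjacent labels of the circuit go to the same factor, so the
  -- relations survive.
  let φ : GraphProduct Γ G →* Monoid.CoprodI (fun _ : Bool => GraphProduct Γ G) :=
    lift (fun v => if v ∈ S then
      (Monoid.CoprodI.of (M := fun _ : Bool => GraphProduct Γ G) (i := decide (v ∈ C))).comp
        (of Γ G v) else 1) (by
      intro v w hvw a b
      split_ifs with hv hw
      · have hvwC : decide (v ∈ C) = decide (w ∈ C) := by
          obtain ⟨e₁, h₁, rfl⟩ := hv
          obtain ⟨e₂, h₂, rfl⟩ := hw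
          exact decide_eq_decide.2 ⟨fun h => hC _ h _ h₂ hvw, fun h => hC _ h _ h₁ hvw.symm⟩
        rw [hvwC]
        exact (of_commute hvw a b).map (Monoid.CoprodI.of
          (M := fun _ : Bool => GraphProduct Γ G) (i := decide (w ∈ C)))
      · exact Commute.one_right _
      · exact Commute.one_left _
      · exact Commute.one_left _)
  let col : (cayleyGraph Γ G).Dart → Bool := fun d => decide (lab d.edge ∈ C)
  let val : (cayleyGraph Γ G).Dart → GraphProduct Γ G := fun d => d.fst⁻¹ * d.snd
  have hφ : ∀ d ∈ p.darts, φ (val d) =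
      Monoid.CoprodI.of (M := fun _ : Bool => GraphProduct Γ G) (i := col d) (val d) := by
    intro d hd
    obtain ⟨a, ha⟩ := hlab d.edge d.edge_mem d.fst d.snd rfl
    have hS : lab d.edge ∈ S := ⟨d.edge, List.mem_map_of_mem hd, rfl⟩
    simp only [val, ← ha, φ, lift_of, if_pos hS]
    rfl
  have hprod : (p.darts.map val).prod = 1 := by
    have := p.getVert_eq_mul_prod p.length
    rwa [SimpleGraph.Walk.getVert_length, ← p.length_darts, List.take_length,
      left_eq_mul] at this
  have hne : p.darts ≠ [] := by
    intro h
    rw [SimpleGraph.Walk.edges, h] at he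
    simp at he
  obtain ⟨l₁, b, l₂, hl, hb, hmono, hb1⟩ :=
    Monoid.CoprodI.exists_subword_prod_eq_one col val hne (by
      rw [← map_one φ, ← hprod, map_list_prod, List.map_map]
      exact congrArg List.prod (List.map_congr_left fun d hd => (hφ d hd).symm))
  have hlen : p.length = l₁.length + b.length + l₂.length := by
    rw [← p.length_darts, hl, List.length_append, List.length_append]
  have hbpos := List.length_pos_iff.2 hb
  have hvert : p.getVert l₁.length = p.getVert (l₁.length + b.length) := by
    rw [p.getVert_eq_mul_prod, p.getVert_eq_mul_prod, hl]
    have h1 : (l₁ ++ b ++ l₂).take l₁.length = l₁ := by simp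
    have h2 : (l₁ ++ b ++ l₂).take (l₁.length + b.length) = l₁ ++ b := by
      rw [← List.length_append, List.take_left]
    rw [h1, h2, List.map_append, List.prod_append]
    change _ = u * (_ * (b.map val).prod)
    rw [hb1, mul_one]
  -- The block `b` has equal end vertices. A circuit repeats a vertex only at its two ends, so `b`
  -- is the whole circuit and all its labels lie on one side.
  have hl₁ : l₁.length = 0 := by
    by_contra h
    have := hp.getVert_injOn (by rw [Set.mem_ofPred_eq]; omega) (by rw [Set.mem_ofPred_eq]; omega)
      hvert
    omega
  have hl₂ : l₂.length = 0 := by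
    by_contra h
    have := hp.getVert_injOn' (by rw [Set.mem_ofPred_eq]; omega)
      (by rw [Set.mem_ofPred_eq]; omega) hvert
    omega
  rw [List.length_eq_zero_iff] at hl₁ hl₂
  subst hl₁ hl₂
  rw [List.nil_append, List.append_nil] at hl
  rw [SimpleGraph.Walk.edges, hl] at he he'
  obtain ⟨d, hd, rfl⟩ := List.mem_map.1 he
  obtain ⟨d', hd', rfl⟩ := List.mem_map.1 he'
  have := hmono d hd d' hd'
  simp only [col, decide_eq_decide] at this
  exact this.1 heC

theorem label_mem_walkBall {lab : Sym2 (GraphProduct Γ G) → V}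
    (hlab : ∀ e ∈ (cayleyGraph Γ G).edgeSet, ∀ a b, e = s(a, b) → a⁻¹ * b ∈ (of Γ G (lab e)).range)
    {u : GraphProduct Γ G} {p : (cayleyGraph Γ G).Walk u u} (hp : p.IsCycle)
    {e e' : Sym2 (GraphProduct Γ G)} (he : e ∈ p.edges) (he' : e' ∈ p.edges) :
    lab e' ∈ Γ.walkBall (lab e) p.length := by
  classical
  -- The component of `lab e` in the subgraph induced on the labels of the circuit. A path in it has
  -- at most `p.length` vertices.
  let C : Set V := {v | ∃ q : Γ.Walk (lab e) v, ∀ x ∈ q.support, x ∈ p.edges.map lab}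
  obtain ⟨q, hq⟩ : lab e' ∈ C := by
    refine label_mem_of_isCycle hlab hp ?_ he ⟨.nil, ?_⟩ he'
    · rintro v ⟨q, hq⟩ e₁ he₁ hadj
      refine ⟨q.concat hadj, fun x hx => ?_⟩
      rw [SimpleGraph.Walk.support_concat, List.mem_append, List.mem_singleton] at hx
      rcases hx with hx | rfl
      · exact hq x hx
      · exact List.mem_map_of_mem he₁
    · intro x hx
      rw [SimpleGraph.Walk.support_nil, List.mem_singleton] at hx
      rw [hx]
      exact List.mem_map_of_mem he
  refine ⟨q.bypass, ?_⟩
  have h1 : q.bypass.support.toFinset ⊆ (p.edges.map lab).toFinset := fun x hx =>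
    List.mem_toFinset.2 (hq x (q.support_bypass_subset_support (List.mem_toFinset.1 hx)))
  have h2 := Finset.card_le_card h1
  rw [List.toFinset_card_of_nodup q.bypass_isPath.support_nodup,
    SimpleGraph.Walk.length_support] at h2
  have h3 := (p.edges.map lab).toFinset_card_le
  rw [List.length_map, SimpleGraph.Walk.length_edges] at h3
  omega

/-- The elements of the vertex groups of a set of vertices. -/
def letters (Γ : SimpleGraph V) (G : V → Type*) [∀ v, Group (G v)] (B : Set V) :
    Set (GraphProduct Γ G) :=
  ⋃ v ∈ B, Set.range (of Γ G v)

/-- A circuit is encoded by a position at which it visits a fixed endpoint of `e` and by its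
successive steps, padded with 1 up to `n`. The steps determine it up to translation, the position
removes this ambiguity. -/
theorem finite_and_card_circuitsThrough_le {e : Sym2 (GraphProduct Γ G)}
    (he : e ∈ (cayleyGraph Γ G).edgeSet) (n : ℕ) :
    ∃ v, (letters Γ G (Γ.walkBall v n)).Finite →
      ((cayleyGraph Γ G).circuitsThrough e n).Finite ∧
        ((cayleyGraph Γ G).circuitsThrough e n).ncard ≤
          (n + 1) * (letters Γ G (Γ.walkBall v n)).ncard ^ n := by
  classical
  -- Provides `choose!` with a value of `lab` on non-edges.
  have hV : Nonempty V := ⟨(exists_edge_label e he).choose⟩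
  choose! lab hlab using exists_edge_label (Γ := Γ) (G := G)
  refine ⟨lab e, fun hfin => ?_⟩
  set L := letters Γ G (Γ.walkBall (lab e) n) with hL
  have : Finite L := hfin
  obtain ⟨a, ha⟩ : ∃ a, a ∈ e := ⟨_, Sym2.out_fst_mem e⟩
  have hpos : ∀ p : (cayleyGraph Γ G).circuitsThrough e n,
      ∃ i : Fin (n + 1), p.1.2.getVert i = a := by
    rintro ⟨⟨u, p⟩, hp, hep, hpn⟩
    obtain ⟨i, hi, hi'⟩ := SimpleGraph.Walk.mem_support_iff_exists_getVert.1
      (SimpleGraph.Walk.mem_support_of_mem_edges hep ha)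
    exact ⟨⟨i, Nat.lt_succ_of_le (hi'.trans hpn)⟩, hi⟩
  choose pos hpos using hpos
  have hstep : ∀ (p : (cayleyGraph Γ G).circuitsThrough e n) (k : ℕ),
      (p.1.2.getVert k)⁻¹ * p.1.2.getVert (k + 1) ∈ L := by
    rintro ⟨⟨u, p⟩, hp, hep, hpn⟩ k
    change (p.getVert k)⁻¹ * p.getVert (k + 1) ∈ L
    change p.length ≤ n at hpn
    simp only [hL, letters, Set.mem_iUnion, exists_prop]
    rcases Nat.lt_or_ge k p.length with hk | hk
    · have hmem : s(p.getVert k, p.getVert (k + 1)) ∈ p.edges :=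
        (p.mk_mem_edges_iff_exists).2 ⟨k, hk, rfl⟩
      obtain ⟨q, hq⟩ := label_mem_walkBall hlab hp hep hmem
      exact ⟨_, ⟨q, hq.trans hpn⟩, hlab _ (p.edges_subset_edgeSet hmem) _ _ rfl⟩
    · rw [p.getVert_of_length_le hk, p.getVert_of_length_le (hk.trans (Nat.le_succ k)),
        inv_mul_cancel]
      exact ⟨lab e, ⟨.nil, Nat.zero_le _⟩, 1, map_one _⟩
  let F : (cayleyGraph Γ G).circuitsThrough e n → Fin (n + 1) × (Fin n → L) :=
    fun p => (pos p, fun k => ⟨_, hstep p k⟩)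
  have hF : Function.Injective F := by
    intro p q hpq
    have hposeq : pos p = pos q := congrArg Prod.fst hpq
    have hsteps : ∀ k, (p.1.2.getVert k)⁻¹ * p.1.2.getVert (k + 1) =
        (q.1.2.getVert k)⁻¹ * q.1.2.getVert (k + 1) := by
      intro k
      rcases Nat.lt_or_ge k n with hk | hk
      · exact congrArg Subtype.val (congrFun (congrArg Prod.snd hpq) ⟨k, hk⟩)
      · have h1 := p.2.2.2
        have h2 := q.2.2.2
        rw [p.1.2.getVert_of_length_le (by omega), p.1.2.getVert_of_length_le (by omega),
          q.1.2.getVert_of_length_le (by omega), q.1.2.getVert_of_length_le (by omega)]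
        simp
    have hrel : ∀ k, p.1.1⁻¹ * p.1.2.getVert k = q.1.1⁻¹ * q.1.2.getVert k := by
      intro k
      induction k with
      | zero => simp
      | succ k ih =>
        have h1 := congrArg₂ (· * ·) ih (hsteps k)
        simpa [mul_assoc] using h1
    have hbase : p.1.1 = q.1.1 := by
      have h1 := hrel (pos p)
      rw [hpos p, hposeq, hpos q] at h1
      exact inv_injective (mul_right_cancel h1)
    obtain ⟨⟨u, p⟩, hp⟩ := p
    obtain ⟨⟨u', q⟩, hq⟩ := q
    change u = u' at hbase
    subst hbase
    obtain rfl : p = q := SimpleGraph.Walk.ext_getVert fun k => mul_left_cancel (hrel k)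
    rfl
  have hfinite := Finite.of_injective F hF
  refine ⟨hfinite, ?_⟩
  have hcard := Nat.card_le_card_of_injective F hF
  rwa [Nat.card_prod, Nat.card_fun, Nat.card_fin, Nat.card_fin, Nat.card_coe_set_eq,
    Nat.card_coe_set_eq] at hcard

end GraphProduct

theorem mainTheorem11 {V : Type*} (Γ : SimpleGraph V) (G : V → Type*) [∀ v, Group (G v)] :
    (4 < Γ.egirth → (GraphProduct.cayleyGraph Γ G).IsHyperbolic) ∧
    (Γ.IsLocallyFinite → (∀ v, Finite (G v)) → (GraphProduct.cayleyGraph Γ G).IsFine) ∧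
    (Γ.IsUniformlyLocallyFinite → (∃ C : ℕ, ∀ v, Finite (G v) ∧ Nat.card (G v) ≤ C) →
      (GraphProduct.cayleyGraph Γ G).IsUniformlyFine) := by
  refine ⟨fun h => ?_, fun hΓ hG e he n => ?_, ?_⟩
  · exact SimpleGraph.isHyperbolic_of_dist_add_dist_le GraphProduct.cayleyGraph_connected
      (GraphProduct.dist_add_dist_le h)
  · obtain ⟨v, hv⟩ := GraphProduct.finite_and_card_circuitsThrough_le he n
    exact (hv ((hΓ.finite_walkBall v n).biUnion fun w _ => Set.finite_range _)).1
  · rintro ⟨C, hC⟩ ⟨D, hD⟩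
    have hΓ : Γ.IsLocallyFinite := fun v =>
      Set.finite_of_encard_le_coe (hC v)
    have hC' : ∀ v, (Γ.neighborSet v).ncard ≤ C := fun v => by
      have := hC v
      rwa [← (hΓ v).cast_ncard_eq, Nat.cast_le] at this
    -- A ball of radius `n` has at most `(C + 1) ^ n` vertices, each contributing at most `D`
    -- letters.
    refine ⟨fun n => (n + 1) * ((C + 1) ^ n * D) ^ n, fun e he n => ?_⟩
    obtain ⟨v, hv⟩ := GraphProduct.finite_and_card_circuitsThrough_le he n
    have hfin := hΓ.finite_walkBall v n
    have hrange : ∀ w, (Set.range (GraphProduct.of Γ G w)).Finite := fun w =>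
      have := (hD w).1
      Set.finite_range _
    obtain ⟨h1, h2⟩ := hv (hfin.biUnion fun w _ => hrange w)
    rw [← h1.cast_ncard_eq, Nat.cast_le]
    refine h2.trans (Nat.mul_le_mul_left _ (Nat.pow_le_pow_left ?_ n))
    refine (Set.ncard_biUnion_le_ncard_mul hfin (fun w _ => hrange w) fun w _ => ?_).trans
      (Nat.mul_le_mul_right D (hΓ.ncard_walkBall_le hC' v n))
    have := (hD w).1
    rw [← Set.image_univ]
    exact (Set.ncard_image_le Set.finite_univ).trans ((Set.ncard_univ _).trans_le (hD w).2)
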